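/- Let $N\ge 3$ be an integer, $\lambda>0$, and let $f:\mathbb{R}\to\mathbb{R}$ be odd. Put $F(s)=\int_0^s f(t)\,dt$ and $G(s)=-\frac{\lambda}{2}s^2+F(s)$. Assume: (f1) $f\in C^1([0,+\infty))$; (f2) $f(u)=o(u)$ as $u\to 0$; (f3) either $f(u)/u\to a$ as $u\to+\infty$ for some constant $a>0$, or $f(u)/u\to+\infty$ as $u\to+\infty$; (f4) there are constants $a_1,a_2>0$ and $p$ with $2<p<2^*:=\frac{2N}{N-2}$ such that $|f'(u)|\le a_1+a_2|u|^{p-2}$ for all $u\ge 0$; (NQ) $\frac12 f(u)u-F(u)\to+\infty$ as $u\to+\infty$, and $\frac12 f(u)u-F(u)>0$ for all $u>0$. Let $H^1(\mathbb{R}^N)$ be the space of real functions $u\in L^2(\mathbb{R}^N)$ with weak gradient $\nabla u\in L^2(\mathbb{R}^N;\mathbb{R}^N)$, with the norm $\|u\|^2=\int_{\mathbb{R}^N}(|\nabla u|^2+u^2)\,dx$. For $u\in H^1(\mathbb{R}^N)$ let $$J(u)=\int_{\mathbb{R}^N}|\nabla u|^2\,dx-\frac{2N}{N-2}\int_{\mathbb{R}^N}G(u)\,dx,\qquad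 \mathcal P=\{u\in H^1(\mathbb{R}^N)\setminus\{0\}: J(u)=0\}.$$ Then: (1) there is $\sigma>0$ such that $\|u\|>\sigma$ for all $u\in\mathcal P$; (2) $\mathcal P$ is closed in $H^1(\mathbb{R}^N)$; (3) $\mathcal P$ is a $C^1$ submanifold of $H^1(\mathbb{R}^N)$ of codimension one. Moreover, $J$ is well defined ($G(u)$ is integrable for every $u\in H^1(\mathbb{R}^N)$) and of class $C^1$ on $H^1(\mathbb{R}^N)$, and $J'(u)u<0$ for every $u\in\mathcal P$. -/

import Mathlib

open MeasureTheory Filter Topology Set Asymptotics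
open scoped ContDiff

/-- `N`-dimensional Euclidean space. -/
abbrev RN (N : ℕ) : Type := EuclideanSpace ℝ (Fin N)

/-- `g` is the weak gradient of `u`: `∫ u ∂ᵢφ = - ∫ gᵢ φ` for every test function
`φ ∈ C_c^∞(ℝ^N)` and every `i`. -/
def IsWeakGradient {N : ℕ} (u : RN N → ℝ) (g : RN N → RN N) : Prop :=
  ∀ φ : RN N → ℝ, ContDiff ℝ ∞ φ → HasCompactSupport φ → ∀ i : Fin N,
    ∫ x, u x * fderiv ℝ φ x (EuclideanSpace.single i 1) = - ∫ x, g x i * φ x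

/-- The Hilbert space `L²(ℝ^N) × L²(ℝ^N; ℝ^N)`, with the norm `(‖u‖₂² + ‖g‖₂²)^{1/2}`. -/
abbrev L2Pair (N : ℕ) : Type :=
  WithLp 2 (Lp ℝ 2 (volume : Measure (RN N)) × Lp (RN N) 2 (volume : Measure (RN N)))

lemma memLp_test {N : ℕ} {φ : RN N → ℝ} (h : ContDiff ℝ ∞ φ) (hc : HasCompactSupport φ) :
    MemLp φ 2 (volume : Measure (RN N)) :=
  h.continuous.memLp_of_hasCompactSupport hc

lemma memLp_test_deriv {N : ℕ} {φ : RN N → ℝ} (h : ContDiff ℝ ∞ φ) (hc : HasCompactSupport φ)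
    (v : RN N) : MemLp (fun x => fderiv ℝ φ x v) 2 (volume : Measure (RN N)) := by
  refine Continuous.memLp_of_hasCompactSupport ?_ ?_
  · exact (h.continuous_fderiv (by simp)).clm_apply continuous_const
  · exact hc.fderiv_apply ℝ v

lemma memLp_coord {N : ℕ} (g : Lp (RN N) 2 (volume : Measure (RN N))) (i : Fin N) :
    MemLp (fun x => g x i) 2 (volume : Measure (RN N)) :=
  (EuclideanSpace.proj i : RN N →L[ℝ] ℝ).comp_memLp' (Lp.memLp g)

/-- The Sobolev space `H¹(ℝ^N) = W^{1,2}(ℝ^N)` of real functions. An element is recorded as the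
pair `(u, ∇u)` of a function `u ∈ L²` and its weak gradient `∇u ∈ L²` (which `u` determines).
The norm and the inner product are inherited from `L2Pair N`, so that
`‖u‖² = ∫ (|∇u|² + u²)`. -/
noncomputable def H1 (N : ℕ) : Submodule ℝ (L2Pair N) where
  carrier := {w | IsWeakGradient (w.fst : RN N → ℝ) (w.snd : RN N → RN N)}
  zero_mem' := by
    intro φ h hc i
    have h1 : (fun x => ((0 : L2Pair N).fst : RN N → ℝ) x *
        fderiv ℝ φ x (EuclideanSpace.single i 1)) =ᵐ[volume] fun _ => 0 := by
      filter_upwards [Lp.coeFn_zero ℝ 2 (volume : Measure (RN N))] with x hx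
      simp
    have h2 : (fun x => ((0 : L2Pair N).snd : RN N → RN N) x i * φ x)
        =ᵐ[volume] fun _ => 0 := by
      filter_upwards [Lp.coeFn_zero (RN N) 2 (volume : Measure (RN N))] with x hx
      simp
    rw [integral_congr_ae h1, integral_congr_ae h2]
    simp
  add_mem' := by
    intro a b ha hb φ h hc i
    have h1 : (fun x => ((a + b).fst : RN N → ℝ) x *
        fderiv ℝ φ x (EuclideanSpace.single i 1)) =ᵐ[volume]
        fun x => a.fst x * fderiv ℝ φ x (EuclideanSpace.single i 1)
          + b.fst x * fderiv ℝ φ x (EuclideanSpace.single i 1) := by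
      filter_upwards [Lp.coeFn_add a.fst b.fst] with x hx
      rw [WithLp.add_fst, hx, Pi.add_apply, add_mul]
    have h2 : (fun x => ((a + b).snd : RN N → RN N) x i * φ x) =ᵐ[volume]
        fun x => a.snd x i * φ x + b.snd x i * φ x := by
      filter_upwards [Lp.coeFn_add a.snd b.snd] with x hx
      rw [WithLp.add_snd, hx, Pi.add_apply, PiLp.add_apply, add_mul]
    rw [integral_congr_ae h1, integral_congr_ae h2, integral_add, integral_add,
      ha φ h hc i, hb φ h hc i]
    · ring
    · exact (memLp_coord a.snd i).integrable_mul (memLp_test h hc)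
    · exact (memLp_coord b.snd i).integrable_mul (memLp_test h hc)
    · exact (Lp.memLp a.fst).integrable_mul (memLp_test_deriv h hc _)
    · exact (Lp.memLp b.fst).integrable_mul (memLp_test_deriv h hc _)
  smul_mem' := by
    intro c a ha φ h hc i
    have h1 : (fun x => ((c • a).fst : RN N → ℝ) x *
        fderiv ℝ φ x (EuclideanSpace.single i 1)) =ᵐ[volume]
        fun x => c * (a.fst x * fderiv ℝ φ x (EuclideanSpace.single i 1)) := by
      filter_upwards [Lp.coeFn_smul c a.fst] with x hx
      rw [WithLp.smul_fst, hx, Pi.smul_apply, smul_eq_mul, mul_assoc]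
    have h2 : (fun x => ((c • a).snd : RN N → RN N) x i * φ x) =ᵐ[volume]
        fun x => c * (a.snd x i * φ x) := by
      filter_upwards [Lp.coeFn_smul c a.snd] with x hx
      rw [WithLp.smul_snd, hx, Pi.smul_apply, PiLp.smul_apply, smul_eq_mul, mul_assoc]
    rw [integral_congr_ae h1, integral_congr_ae h2, integral_const_mul, integral_const_mul,
      ha φ h hc i]
    ring

namespace H1

/-- The function underlying an element of `H¹(ℝ^N)`. -/
noncomputable def fn {N : ℕ} (u : H1 N) : Lp ℝ 2 (volume : Measure (RN N)) := u.1.fst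

/-- The weak gradient of an element of `H¹(ℝ^N)`. -/
noncomputable def grad {N : ℕ} (u : H1 N) : Lp (RN N) 2 (volume : Measure (RN N)) := u.1.snd

/-- The norm of `H1 N` is the usual one. -/
lemma norm_sq_eq {N : ℕ} (u : H1 N) :
    ‖u‖ ^ 2 = ∫ x, (‖H1.grad u x‖ ^ 2 + (H1.fn u x) ^ 2) := by
  have key : ∀ {V : Type} [NormedAddCommGroup V] [InnerProductSpace ℝ V]
      (h : Lp V 2 (volume : Measure (RN N))), ‖h‖ ^ 2 = ∫ x, ‖h x‖ ^ 2 := by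
    intro V _ _ h
    rw [← real_inner_self_eq_norm_sq, L2.inner_def]
    simp
  have e : ‖u‖ ^ 2 = ‖H1.fn u‖ ^ 2 + ‖H1.grad u‖ ^ 2 :=
    WithLp.prod_norm_sq_eq_of_L2 u.1
  have i1 : Integrable (fun x => ‖H1.grad u x‖ ^ 2) :=
    (Lp.memLp (H1.grad u)).integrable_norm_pow (p := 2) (by norm_num)
  have i2 : Integrable (fun x => (H1.fn u x) ^ 2) := (Lp.memLp (H1.fn u)).integrable_sq
  rw [e, key, key, integral_add i1 i2, add_comm]
  simp

end H1

/-- The primitive `F(s) = ∫₀ˢ f(t) dt`. -/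
noncomputable def primF (f : ℝ → ℝ) (s : ℝ) : ℝ := ∫ t in (0 : ℝ)..s, f t

/-- `G(s) = -(λ/2) s² + F(s)`. -/
noncomputable def potG (lam : ℝ) (f : ℝ → ℝ) (s : ℝ) : ℝ := -(lam / 2) * s ^ 2 + primF f s

/-- The Pohozaev functional `J(u) = ∫ |∇u|² - (2N/(N-2)) ∫ G(u)` on `H¹(ℝ^N)`. -/
noncomputable def pohozaevJ (N : ℕ) (lam : ℝ) (f : ℝ → ℝ) (u : H1 N) : ℝ :=
  (∫ x, ‖H1.grad u x‖ ^ 2) - 2 * (N : ℝ) / ((N : ℝ) - 2) * ∫ x, potG lam f (H1.fn u x)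

/-- The Pohozaev manifold `P = {u ∈ H¹(ℝ^N) \ {0} : J(u) = 0}`. -/
def pohozaevManifold (N : ℕ) (lam : ℝ) (f : ℝ → ℝ) : Set (H1 N) :=
  {u | u ≠ 0 ∧ pohozaevJ N lam f u = 0}

/-- `S` is a (boundaryless, embedded) `C¹` submanifold of codimension one of the normed space `E`:
near each of its points, some `C¹` diffeomorphism between open subsets of `E` carries `S` onto an
open piece of a closed linear hyperplane. -/
def IsC1Hypersurface {E : Type*} [NormedAddCommGroup E] [NormedSpace ℝ E] (S : Set E) : Prop :=
  ∀ x ∈ S, ∃ (Φ : OpenPartialHomeomorph E E) (V : Submodule ℝ E),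
    x ∈ Φ.source ∧ ContDiffOn ℝ 1 Φ Φ.source ∧ ContDiffOn ℝ 1 Φ.symm Φ.target ∧
    IsClosed (V : Set E) ∧ Module.finrank ℝ (E ⧸ V) = 1 ∧
    Φ '' (S ∩ Φ.source) = (V : Set E) ∩ Φ.target

/-! Write κ = 2N/(N-2) and g(s) = f(s) - λs, so that G is the primitive of g and J(u) = ‖∇u‖² -
κ∫G(u). The growth bound on f' makes g locally Lipschitz with constants of order |s|^(p-2). Together
with the Sobolev embedding H¹ ⊂ L^p and Hölder's inequality, this makes u ↦ ∫G(u) a C¹ functional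
(`exists_fderiv_integral_primF`). The embedding comes from the Gagliardo–Nirenberg–Sobolev
inequality for compactly supported C¹ functions, by mollification, cutoff and Fatou, and then by
interpolation between L² and the critical space.

If J(u) = 0, then J'(u)u = J'(u)u - 2J(u) = -2κ∫(½f(u)u - F(u)): the λ terms cancel, and (NQ) with
oddness makes this negative for u ≠ 0 (`pohozaev_radial_deriv_neg`). Hence every point of P is a
regular zero of J, and the inverse function theorem gives the hypersurface
(`isC1Hypersurface_of_contDiff`).

Since |F(s)| ≤ εs² + C|s|^p, the equation J(u) = 0 reads m‖u‖² ≤ κ∫F(u) ≤ (m/2)‖u‖² + C'‖u‖^p with p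
> 2, which excludes small u ≠ 0. Once P avoids a ball around 0, it is closed, because J is
continuous. -/

/-! ### Mollification and the Sobolev embedding. -/

open scoped Convolution ENNReal NNReal in
/-- Convolution with a probability density does not increase the `L²` norm. -/
lemma eLpNorm_two_convolution_le {N : ℕ} {V : Type*} [NormedAddCommGroup V] [NormedSpace ℝ V]
    {ρ : RN N → ℝ} (hρ : Continuous ρ) (hρ0 : ∀ x, 0 ≤ ρ x)
    (hρ1 : ∫⁻ x, ENNReal.ofReal (ρ x) = 1) {h : RN N → V} (hh : StronglyMeasurable h) :
    eLpNorm (ρ ⋆[ContinuousLinearMap.lsmul ℝ ℝ, volume] h) 2 volume ≤ eLpNorm h 2 volume := by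
  have hmeas : Measurable fun x => ENNReal.ofReal (ρ x) := hρ.measurable.ennreal_ofReal
  -- The convolution is an average of translates of `h` against the probability measure `ν`. Jensen
  -- bounds its square pointwise; Tonelli and translation invariance do the rest.
  set ν : Measure (RN N) := volume.withDensity fun x => ENNReal.ofReal (ρ x) with hν
  have : IsProbabilityMeasure ν :=
    ⟨by rw [hν, withDensity_apply _ MeasurableSet.univ]; simpa using hρ1⟩
  have sq : ∀ {W : Type _} [NormedAddCommGroup W] (k : RN N → W) (m : Measure (RN N)),
      eLpNorm k 2 m ^ 2 = ∫⁻ x, ‖k x‖ₑ ^ 2 ∂m := by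
    intro W _ k m
    have := eLpNorm_nnreal_pow_eq_lintegral (f := k) (μ := m) (p := 2) (by norm_num)
    simpa using this
  have key : ∀ x, ‖(ρ ⋆[ContinuousLinearMap.lsmul ℝ ℝ, volume] h) x‖ₑ ^ 2
      ≤ ∫⁻ t, ‖h (x - t)‖ₑ ^ 2 ∂ν := by
    intro x
    have hm : StronglyMeasurable fun t => h (x - t) :=
      hh.comp_measurable (measurable_const.sub measurable_id)
    rw [← sq (fun t => h (x - t)) ν]
    gcongr
    calc ‖(ρ ⋆[ContinuousLinearMap.lsmul ℝ ℝ, volume] h) x‖ₑ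
        ≤ ∫⁻ t, ‖ρ t • h (x - t)‖ₑ := enorm_integral_le_lintegral_enorm _
      _ = ∫⁻ t, ENNReal.ofReal (ρ t) * ‖h (x - t)‖ₑ := by
          refine lintegral_congr fun t => ?_
          rw [enorm_smul, Real.enorm_of_nonneg (hρ0 t)]
      _ = ∫⁻ t, ‖h (x - t)‖ₑ ∂ν := by
          rw [hν, lintegral_withDensity_eq_lintegral_mul _ hmeas hm.enorm]
          rfl
      _ = eLpNorm (fun t => h (x - t)) 1 ν := eLpNorm_one_eq_lintegral_enorm.symm
      _ ≤ eLpNorm (fun t => h (x - t)) 2 ν :=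
          eLpNorm_le_eLpNorm_of_exponent_le (by norm_num) hm.aestronglyMeasurable
  have : eLpNorm (ρ ⋆[ContinuousLinearMap.lsmul ℝ ℝ, volume] h) 2 volume ^ 2
      ≤ eLpNorm h 2 volume ^ 2 := by
    rw [sq, sq]
    calc ∫⁻ x, ‖(ρ ⋆[ContinuousLinearMap.lsmul ℝ ℝ, volume] h) x‖ₑ ^ 2
        ≤ ∫⁻ x, ∫⁻ t, ‖h (x - t)‖ₑ ^ 2 ∂ν := lintegral_mono key
      _ = ∫⁻ t, ∫⁻ x, ‖h (x - t)‖ₑ ^ 2 ∂volume ∂ν := by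
          refine lintegral_lintegral_swap ?_
          exact ((hh.enorm.comp (measurable_fst.sub measurable_snd)).pow_const 2).aemeasurable
      _ = ∫⁻ t, (∫⁻ x, ‖h x‖ₑ ^ 2) ∂ν := by
          refine lintegral_congr fun t => ?_
          exact lintegral_sub_right_eq_self (fun x => ‖h x‖ₑ ^ 2) t
      _ = ∫⁻ x, ‖h x‖ₑ ^ 2 := by simp
  exact (ENNReal.pow_le_pow_left_iff two_ne_zero).1 this

open scoped Convolution in
/-- The derivative of a mollification is the mollification of the weak gradient. -/
lemma fderiv_convolution_eq_of_isWeakGradient {N : ℕ} {u : RN N → ℝ} {g : RN N → RN N}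
    (hu : LocallyIntegrable u) (hg : LocallyIntegrable g) (h : IsWeakGradient u g)
    {ρ : RN N → ℝ} (hρ : ContDiff ℝ ∞ ρ) (hρc : HasCompactSupport ρ) (x : RN N) :
    fderiv ℝ (ρ ⋆[ContinuousLinearMap.lsmul ℝ ℝ, volume] u) x =
      innerSL ℝ ((ρ ⋆[ContinuousLinearMap.lsmul ℝ ℝ, volume] g) x) := by
  have hder := hρc.hasFDerivAt_convolution_left (ContinuousLinearMap.lsmul ℝ ℝ)
    (hρ.of_le (by simp)) hu x
  have hex : ConvolutionExists (fderiv ℝ ρ) u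
      ((ContinuousLinearMap.lsmul ℝ ℝ).precompL (RN N)) volume :=
    (hρc.fderiv ℝ).convolutionExists_left _ (hρ.continuous_fderiv (by simp)) hu
  have hexg : ConvolutionExists ρ g (ContinuousLinearMap.lsmul ℝ ℝ) volume :=
    hρc.convolutionExists_left _ hρ.continuous hg
  rw [hder.fderiv]
  have hlin : ∀ i : Fin N,
      ((fderiv ℝ ρ ⋆[(ContinuousLinearMap.lsmul ℝ ℝ).precompL (RN N), volume] u) x)
        (EuclideanSpace.single i 1) =
      ((ρ ⋆[ContinuousLinearMap.lsmul ℝ ℝ, volume] g) x) i := by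
    intro i
    have h1 : ((fderiv ℝ ρ ⋆[(ContinuousLinearMap.lsmul ℝ ℝ).precompL (RN N), volume] u) x)
        (EuclideanSpace.single i 1) =
        ∫ t, u t * fderiv ℝ ρ (x - t) (EuclideanSpace.single i 1) := by
      rw [convolution_eq_swap, ContinuousLinearMap.integral_apply (hex x).integrable_swap]
      refine integral_congr_ae (Eventually.of_forall fun t => ?_)
      simp [mul_comm]
    have h2 : ((ρ ⋆[ContinuousLinearMap.lsmul ℝ ℝ, volume] g) x) i =
        ∫ t, g t i * ρ (x - t) := by
      rw [convolution_eq_swap]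
      have := ContinuousLinearMap.integral_comp_comm (EuclideanSpace.proj i : RN N →L[ℝ] ℝ)
        (hexg x).integrable_swap
      refine this.symm.trans (integral_congr_ae (Eventually.of_forall fun t => ?_))
      simp [mul_comm]
    -- The test function is the reflected kernel; its chain-rule sign cancels the sign in the
    -- definition of the weak gradient.
    have h3 := h (fun t => ρ (x - t)) (hρ.comp (contDiff_const.sub contDiff_id))
      (hρc.comp_homeomorph (Homeomorph.subLeft x)) i
    have h4 : ∀ t, fderiv ℝ (fun t => ρ (x - t)) t (EuclideanSpace.single i 1) =
        - fderiv ℝ ρ (x - t) (EuclideanSpace.single i 1) := by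
      intro t
      have hd : HasFDerivAt (fun t => ρ (x - t))
          ((fderiv ℝ ρ (x - t)).comp (-ContinuousLinearMap.id ℝ (RN N))) t :=
        ((hρ.differentiable (by simp)).differentiableAt.hasFDerivAt).comp t
          ((hasFDerivAt_id t).const_sub x)
      rw [hd.fderiv]
      simp
    simp only [h4, mul_neg, integral_neg] at h3
    rw [h1, h2]
    linarith
  refine ContinuousLinearMap.coe_injective
    ((EuclideanSpace.basisFun (Fin N) ℝ).toBasis.ext fun i => ?_)
  simpa [EuclideanSpace.inner_single_right] using hlin i

lemma H1.norm_fn_le {N : ℕ} (u : H1 N) : ‖H1.fn u‖ ≤ ‖u‖ := WithLp.norm_fst_le _ u.1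

lemma H1.norm_grad_le {N : ℕ} (u : H1 N) : ‖H1.grad u‖ ≤ ‖u‖ := WithLp.norm_snd_le _ u.1

/-- A smooth cutoff function with support in a ball exists at every scale, with uniformly
bounded derivative. -/
lemma exists_cutoff_seq (N : ℕ) : ∃ (η : ℕ → RN N → ℝ) (C : ℝ), 0 ≤ C ∧
    (∀ k, ContDiff ℝ ∞ (η k)) ∧ (∀ k, HasCompactSupport (η k)) ∧ (∀ k x, |η k x| ≤ 1) ∧
    (∀ k x, ‖fderiv ℝ (η k) x‖ ≤ C) ∧ ∀ x, ∀ᶠ k in atTop, η k x = 1 := by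
  let b : ContDiffBump (0 : RN N) := ⟨1, 2, by norm_num, by norm_num⟩
  have hb : ContDiff ℝ ∞ b := b.contDiff
  obtain ⟨C, hC⟩ := (hb.continuous_fderiv (by simp)).bounded_above_of_compact_support
    (b.hasCompactSupport.fderiv ℝ)
  have hC0 : 0 ≤ C := (norm_nonneg _).trans (hC 0)
  have hc : ∀ k : ℕ, ((k : ℝ) + 1)⁻¹ ≠ 0 := fun k => by positivity
  -- Dilating one fixed bump multiplies its derivative by 1/(k+1) ≤ 1, so a single `C` serves all
  -- scales.
  refine ⟨fun k x => b (((k : ℝ) + 1)⁻¹ • x), C, hC0, fun k => ?_, fun k => ?_, fun k x => ?_,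
    fun k x => ?_, fun x => ?_⟩
  · exact hb.comp (contDiff_const_smul _)
  · exact b.hasCompactSupport.comp_smul (hc k)
  · rw [abs_of_nonneg b.nonneg]
    exact b.le_one
  · have hd : HasFDerivAt (fun x => b (((k : ℝ) + 1)⁻¹ • x))
        ((fderiv ℝ b (((k : ℝ) + 1)⁻¹ • x)).comp
          (((k : ℝ) + 1)⁻¹ • ContinuousLinearMap.id ℝ (RN N))) x :=
      ((hb.differentiable (by simp)).differentiableAt.hasFDerivAt).comp x
        ((hasFDerivAt_id x).const_smul (((k : ℝ) + 1)⁻¹))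
    rw [hd.fderiv, ContinuousLinearMap.comp_smul, ContinuousLinearMap.comp_id, norm_smul,
      Real.norm_of_nonneg (by positivity)]
    have h1 : ((k : ℝ) + 1)⁻¹ ≤ 1 := inv_le_one_of_one_le₀ (by linarith [k.cast_nonneg (α := ℝ)])
    calc ((k : ℝ) + 1)⁻¹ * ‖fderiv ℝ b (((k : ℝ) + 1)⁻¹ • x)‖ ≤ 1 * C :=
          mul_le_mul h1 (hC _) (norm_nonneg _) zero_le_one
      _ = C := one_mul C
  · filter_upwards [eventually_ge_atTop ⌈‖x‖⌉₊] with k hk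
    refine b.one_of_mem_closedBall ?_
    rw [mem_closedBall_zero_iff, norm_smul, Real.norm_of_nonneg (by positivity)]
    have h1 : ‖x‖ ≤ k := (Nat.le_ceil _).trans (by exact_mod_cast hk)
    rw [inv_mul_le_iff₀ (by positivity)]
    change ‖x‖ ≤ ((k : ℝ) + 1) * 1
    linarith

open scoped Convolution ENNReal NNReal in
/-- The Sobolev inequality on `H¹(ℝ^N)` with the critical exponent. -/
lemma exists_eLpNorm_critical_le {N : ℕ} (hN : 3 ≤ N) {r : ℝ≥0}
    (hr : (r : ℝ)⁻¹ = 2⁻¹ - (N : ℝ)⁻¹) :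
    ∃ C : ℝ≥0, ∀ u : H1 N, eLpNorm (H1.fn u) r volume ≤ C * ENNReal.ofReal ‖u‖ := by
  obtain ⟨η, C, hC0, hηs, hηc, hη1, hηd, hηlim⟩ := exists_cutoff_seq N
  set S : ℝ≥0 := eLpNormLESNormFDerivOfEqInnerConst (volume : Measure (RN N)) (2 : ℝ≥0) with hS
  refine ⟨S * (1 + C.toNNReal), fun u => ?_⟩
  -- The radii shrink with fixed ratio 2; a bounded ratio is what almost everywhere convergence of
  -- the mollifications requires.
  let φ : ℕ → ContDiffBump (0 : RN N) := fun k =>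
    ⟨((k : ℝ) + 1)⁻¹, 2 * ((k : ℝ) + 1)⁻¹, by positivity, by
      have : 0 < ((k : ℝ) + 1)⁻¹ := by positivity
      linarith⟩
  let ρ : ℕ → RN N → ℝ := fun k => (φ k).normed volume
  have hρs : ∀ k, ContDiff ℝ ∞ (ρ k) := fun k => (φ k).contDiff_normed
  have hρc : ∀ k, HasCompactSupport (ρ k) := fun k => (φ k).hasCompactSupport_normed
  have hρ0 : ∀ k x, 0 ≤ ρ k x := fun k x => (φ k).nonneg_normed x
  have hρ1 : ∀ k, ∫⁻ x, ENNReal.ofReal (ρ k x) = 1 := fun k => by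
    rw [← ofReal_integral_eq_lintegral_ofReal (φ k).integrable_normed
      (Eventually.of_forall (hρ0 k)), (φ k).integral_normed, ENNReal.ofReal_one]
  have hul : LocallyIntegrable (H1.fn u) volume :=
    (Lp.memLp (H1.fn u)).locallyIntegrable (by norm_num)
  have hgl : LocallyIntegrable (H1.grad u) volume :=
    (Lp.memLp (H1.grad u)).locallyIntegrable (by norm_num)
  have hw : IsWeakGradient (H1.fn u) (H1.grad u) := u.2
  let v : ℕ → RN N → ℝ := fun k =>
    (ρ k) ⋆[ContinuousLinearMap.lsmul ℝ ℝ, volume] (H1.fn u : RN N → ℝ)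
  have hv : ∀ k, ContDiff ℝ 1 (v k) := fun k =>
    (hρc k).contDiff_convolution_left (n := 1) _ ((hρs k).of_le (by simp)) hul
  let w : ℕ → RN N → ℝ := fun k x => η k x * v k x
  have hws : ∀ k, ContDiff ℝ 1 (w k) := fun k => ((hηs k).of_le (by simp)).mul (hv k)
  have hwc : ∀ k, HasCompactSupport (w k) := fun k => (hηc k).mul_right
  have hlim : ∀ᵐ x ∂(volume : Measure (RN N)),
      Tendsto (fun k => w k x) atTop (𝓝 (H1.fn u x)) := by
    have hr0 : Tendsto (fun k => (φ k).rOut) atTop (𝓝 0) := by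
      have := (tendsto_inv_atTop_zero.comp
        (tendsto_atTop_add_const_right atTop (1 : ℝ) tendsto_natCast_atTop_atTop)).const_mul (2 : ℝ)
      simpa using this
    filter_upwards [ContDiffBump.ae_convolution_tendsto_right_of_locallyIntegrable
      (φ := φ) (K := 2) hr0 (Eventually.of_forall fun k => le_rfl) hul] with x hx
    refine hx.congr' ?_
    filter_upwards [hηlim x] with k hk
    change _ = η k x * v k x
    rw [hk, one_mul]
  have hbound : ∀ k, eLpNorm (w k) r volume ≤
      (S * (1 + C.toNNReal) : ℝ≥0) * ENNReal.ofReal ‖u‖ := by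
    intro k
    have h1 := eLpNorm_le_eLpNorm_fderiv_of_eq_inner (volume : Measure (RN N)) (hws k) (hwc k)
      (p := 2) (p' := r) (by norm_num) (by simp; omega) (by simpa using hr)
    have hvd : fderiv ℝ (v k) = fun x => innerSL ℝ
        (((ρ k) ⋆[ContinuousLinearMap.lsmul ℝ ℝ, volume] (H1.grad u : RN N → RN N)) x) :=
      funext fun x => fderiv_convolution_eq_of_isWeakGradient hul hgl hw (hρs k) (hρc k) x
    -- In the product rule the first term is controlled by the gradient of `u` and the second by `C`
    -- times its L² norm, whence the factor 1 + C.
    have hd : fderiv ℝ (w k) = (fun x => η k x • fderiv ℝ (v k) x) +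
        fun x => v k x • fderiv ℝ (η k) x := by
      funext x
      exact fderiv_mul ((hηs k).differentiable (by simp)).differentiableAt
        ((hv k).differentiable (by simp)).differentiableAt
    have h2 : eLpNorm (fun x => η k x • fderiv ℝ (v k) x) 2 volume ≤ ENNReal.ofReal ‖u‖ := by
      calc eLpNorm (fun x => η k x • fderiv ℝ (v k) x) 2 volume
          ≤ eLpNorm ((ρ k) ⋆[ContinuousLinearMap.lsmul ℝ ℝ, volume]
              (H1.grad u : RN N → RN N)) 2 volume := by
            refine eLpNorm_mono fun x => ?_
            rw [norm_smul, hvd, innerSL_apply_norm]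
            exact mul_le_of_le_one_left (norm_nonneg _) (hη1 k x)
        _ ≤ eLpNorm (H1.grad u) 2 volume :=
            eLpNorm_two_convolution_le (hρs k).continuous (hρ0 k) (hρ1 k) (Lp.stronglyMeasurable _)
        _ = ENNReal.ofReal ‖H1.grad u‖ := by rw [ofReal_norm, Lp.enorm_def]
        _ ≤ ENNReal.ofReal ‖u‖ := ENNReal.ofReal_le_ofReal (H1.norm_grad_le u)
    have h3 : eLpNorm (fun x => v k x • fderiv ℝ (η k) x) 2 volume ≤
        C.toNNReal * ENNReal.ofReal ‖u‖ := by
      calc eLpNorm (fun x => v k x • fderiv ℝ (η k) x) 2 volume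
          ≤ C.toNNReal • eLpNorm (v k) 2 volume := by
            refine eLpNorm_le_nnreal_smul_eLpNorm_of_ae_le_mul (Eventually.of_forall fun x => ?_) 2
            rw [nnnorm_smul, mul_comm]
            gcongr
            rw [← NNReal.coe_le_coe, Real.coe_toNNReal C hC0]
            exact hηd k x
        _ ≤ C.toNNReal * eLpNorm (H1.fn u) 2 volume := by
            rw [ENNReal.smul_def, smul_eq_mul]
            gcongr
            exact eLpNorm_two_convolution_le (hρs k).continuous (hρ0 k) (hρ1 k)
              (Lp.stronglyMeasurable _)
        _ = C.toNNReal * ENNReal.ofReal ‖H1.fn u‖ := by rw [ofReal_norm, Lp.enorm_def]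
        _ ≤ C.toNNReal * ENNReal.ofReal ‖u‖ := by
            gcongr
            exact H1.norm_fn_le u
    have hm1 : AEStronglyMeasurable (fun x => η k x • fderiv ℝ (v k) x) volume :=
      ((hηs k).continuous.smul ((hv k).continuous_fderiv (by simp))).aestronglyMeasurable
    have hm2 : AEStronglyMeasurable (fun x => v k x • fderiv ℝ (η k) x) volume :=
      ((hv k).continuous.smul ((hηs k).continuous_fderiv (by simp))).aestronglyMeasurable
    calc eLpNorm (w k) r volume ≤ S * eLpNorm (fderiv ℝ (w k)) 2 volume := h1
      _ ≤ S * (ENNReal.ofReal ‖u‖ + C.toNNReal * ENNReal.ofReal ‖u‖) := by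
          gcongr
          rw [hd]
          exact (eLpNorm_add_le hm1 hm2 (by norm_num)).trans (add_le_add h2 h3)
      _ = (S * (1 + C.toNNReal) : ℝ≥0) * ENNReal.ofReal ‖u‖ := by
          push_cast
          ring
  -- Fatou's lemma: only almost everywhere convergence of `w k` is needed.
  calc eLpNorm (H1.fn u) r volume
      ≤ atTop.liminf fun k => eLpNorm (w k) r volume :=
        Lp.eLpNorm_lim_le_liminf_eLpNorm
          (fun k => (hws k).continuous.aestronglyMeasurable) _ hlim
    _ ≤ atTop.liminf fun _ : ℕ => (S * (1 + C.toNNReal) : ℝ≥0) * ENNReal.ofReal ‖u‖ :=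
        liminf_le_liminf (Eventually.of_forall hbound)
    _ = _ := liminf_const _

open scoped ENNReal NNReal in
/-- The Sobolev embedding of `H¹(ℝ^N)` into `L^p` for `2 < p < 2N/(N-2)`. -/
lemma exists_lintegral_rpow_le {N : ℕ} (hN : 3 ≤ N) {p : ℝ} (hp2 : 2 < p)
    (hp : p < 2 * (N : ℝ) / ((N : ℝ) - 2)) :
    ∃ K : ℝ, 0 < K ∧ ∀ u : H1 N,
      ∫⁻ x, ‖H1.fn u x‖ₑ ^ p ≤ ENNReal.ofReal (K * ‖u‖) ^ p := by
  have hN' : (3 : ℝ) ≤ N := by exact_mod_cast hN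
  set r : ℝ := 2 * (N : ℝ) / ((N : ℝ) - 2) with hr
  have hr0 : 0 < r := by linarith
  have hrinv : ((r.toNNReal : ℝ≥0) : ℝ)⁻¹ = 2⁻¹ - (N : ℝ)⁻¹ := by
    rw [Real.coe_toNNReal _ hr0.le, hr]
    field_simp
  obtain ⟨C, hC⟩ := exists_eLpNorm_critical_le hN hrinv
  -- C + 1 dominates both 1, the constant for L², and `C`, the constant for the critical exponent.
  refine ⟨(C : ℝ) + 1, by positivity, fun u => ?_⟩
  set A : ℝ≥0∞ := ENNReal.ofReal (((C : ℝ) + 1) * ‖u‖) with hA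
  have hA2 : ∫⁻ x, ‖H1.fn u x‖ₑ ^ (2 : ℝ) ≤ A ^ (2 : ℝ) := by
    have h1 := eLpNorm_nnreal_pow_eq_lintegral (f := H1.fn u) (μ := volume) (p := 2) (by norm_num)
    simp only [NNReal.coe_ofNat, ENNReal.coe_ofNat] at h1
    rw [← h1, ← Lp.enorm_def, ← ofReal_norm, hA]
    gcongr
    nlinarith [H1.norm_fn_le u, norm_nonneg u, C.2]
  have hAr : ∫⁻ x, ‖H1.fn u x‖ₑ ^ r ≤ A ^ r := by
    have h1 := eLpNorm_nnreal_pow_eq_lintegral (f := H1.fn u) (μ := volume) (p := r.toNNReal)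
      (by simpa using hr0)
    rw [Real.coe_toNNReal _ hr0.le] at h1
    rw [← h1]
    gcongr
    refine (hC u).trans ?_
    rw [hA, ENNReal.ofReal_mul (by positivity)]
    gcongr
    rw [← ENNReal.ofReal_coe_nnreal]
    gcongr
    linarith
  -- The interpolation weight: it solves 2θ + r(1-θ) = p.
  set θ : ℝ := (r - p) / (r - 2) with hθ
  have hr2 : 0 < r - 2 := by linarith
  have hθ0 : 0 ≤ θ := div_nonneg (by linarith) hr2.le
  have hθ1 : 0 ≤ 1 - θ := by
    rw [hθ, sub_nonneg, div_le_one hr2]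
    linarith
  have hθp : 2 * θ + r * (1 - θ) = p := by
    rw [hθ]
    field_simp
    ring
  have hm : AEMeasurable (fun x => ‖H1.fn u x‖ₑ) volume :=
    (Lp.aestronglyMeasurable (H1.fn u)).enorm
  have split : ∀ a : ℝ≥0∞, a ^ p = (a ^ (2 : ℝ)) ^ θ * (a ^ r) ^ (1 - θ) := by
    intro a
    rw [← ENNReal.rpow_mul, ← ENNReal.rpow_mul, ← ENNReal.rpow_add_of_nonneg _ _
      (by positivity) (mul_nonneg hr0.le hθ1), hθp]
  calc ∫⁻ x, ‖H1.fn u x‖ₑ ^ p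
      = ∫⁻ x, (‖H1.fn u x‖ₑ ^ (2 : ℝ)) ^ θ * (‖H1.fn u x‖ₑ ^ r) ^ (1 - θ) :=
        lintegral_congr fun x => split _
    _ ≤ (∫⁻ x, ‖H1.fn u x‖ₑ ^ (2 : ℝ)) ^ θ * (∫⁻ x, ‖H1.fn u x‖ₑ ^ r) ^ (1 - θ) :=
        ENNReal.lintegral_mul_norm_pow_le (hm.pow_const _) (hm.pow_const _) hθ0 hθ1 (by ring)
    _ ≤ (A ^ (2 : ℝ)) ^ θ * (A ^ r) ^ (1 - θ) := by gcongr
    _ = A ^ p := (split A).symm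

/-! ### Integral estimates from Hölder's inequality. -/

/-- The embedding inequality `‖u‖_p ≤ K ‖u‖` on `H¹(ℝ^N)`. -/
def SobolevBound (N : ℕ) (p K : ℝ) : Prop :=
  ∀ u : H1 N, ∫⁻ x, ‖H1.fn u x‖ₑ ^ p ≤ ENNReal.ofReal (K * ‖u‖) ^ p

lemma H1.memLp_fn {N : ℕ} (u : H1 N) : MemLp (H1.fn u) 2 (volume : Measure (RN N)) :=
  Lp.memLp _

lemma H1.coeFn_fn_add {N : ℕ} (u v : H1 N) :
    ∀ᵐ x ∂(volume : Measure (RN N)), H1.fn (u + v) x = H1.fn u x + H1.fn v x :=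
  Lp.coeFn_add (H1.fn u) (H1.fn v)

lemma H1.coeFn_fn_smul {N : ℕ} (c : ℝ) (u : H1 N) :
    ∀ᵐ x ∂(volume : Measure (RN N)), H1.fn (c • u) x = c * H1.fn u x :=
  Lp.coeFn_smul c (H1.fn u)

lemma integral_abs_mul_abs_le {N : ℕ} (v w : H1 N) :
    Integrable (fun x => |H1.fn v x| * |H1.fn w x|) ∧
      ∫ x, |H1.fn v x| * |H1.fn w x| ≤ ‖v‖ * ‖w‖ := by
  have hi : Integrable (fun x => |H1.fn v x| * |H1.fn w x|) :=
    (H1.memLp_fn v).abs.integrable_mul (H1.memLp_fn w).abs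
  refine ⟨hi, ?_⟩
  have h1 : ∫ x, |H1.fn v x| * |H1.fn w x| = inner ℝ |H1.fn v| |H1.fn w| := by
    rw [L2.inner_def]
    refine integral_congr_ae ?_
    filter_upwards [Lp.coeFn_abs (H1.fn v), Lp.coeFn_abs (H1.fn w)] with x hv hw
    simp [hv, hw, mul_comm]
  rw [h1]
  calc inner ℝ |H1.fn v| |H1.fn w| ≤ ‖|H1.fn v|‖ * ‖|H1.fn w|‖ := real_inner_le_norm _ _
    _ = ‖H1.fn v‖ * ‖H1.fn w‖ := by rw [norm_abs_eq_norm, norm_abs_eq_norm]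
    _ ≤ ‖v‖ * ‖w‖ := mul_le_mul (H1.norm_fn_le v) (H1.norm_fn_le w) (norm_nonneg _) (norm_nonneg _)

/-- Hölder with three factors and weights q/p, 1/p, 1/p for p = q + 2, which sum to 1; every factor
is then measured in L^p, where the Sobolev bound applies. -/
lemma integral_rpow_mul_abs_mul_abs_le {N : ℕ} {q K : ℝ} (hq : 0 < q) (hK : 0 < K)
    (hS : SobolevBound N (q + 2) K) (a v w : H1 N) :
    Integrable (fun x => |H1.fn a x| ^ q * (|H1.fn v x| * |H1.fn w x|)) ∧
      ∫ x, |H1.fn a x| ^ q * (|H1.fn v x| * |H1.fn w x|)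
        ≤ K ^ (q + 2) * ‖a‖ ^ q * (‖v‖ * ‖w‖) := by
  set p : ℝ := q + 2 with hp
  have hp0 : 0 < p := by linarith
  have hm : ∀ u : H1 N, AEStronglyMeasurable (H1.fn u) volume := fun u => (H1.memLp_fn u).1
  have key : ∫⁻ x, ‖|H1.fn a x| ^ q * (|H1.fn v x| * |H1.fn w x|)‖ₑ
      ≤ ENNReal.ofReal (K ^ p * ‖a‖ ^ q * (‖v‖ * ‖w‖)) := by
    have hH := ENNReal.lintegral_prod_norm_pow_le (μ := (volume : Measure (RN N)))
      (Finset.univ : Finset (Fin 3))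
      (f := ![fun x => ‖H1.fn a x‖ₑ ^ p, fun x => ‖H1.fn v x‖ₑ ^ p, fun x => ‖H1.fn w x‖ₑ ^ p])
      (p := ![q / p, 1 / p, 1 / p])
      (by
        intro i _
        fin_cases i
        exacts [(hm a).enorm.pow_const _, (hm v).enorm.pow_const _, (hm w).enorm.pow_const _])
      (by
        simp only [Fin.sum_univ_three, Matrix.cons_val]
        field_simp
        rw [hp]
        ring)
      (by
        intro i _
        fin_cases i
        exacts [div_nonneg hq.le hp0.le, div_nonneg zero_le_one hp0.le,
          div_nonneg zero_le_one hp0.le])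
    simp only [Fin.prod_univ_three, Matrix.cons_val] at hH
    have e1 : ∀ (b : ENNReal) (s : ℝ), (b ^ p) ^ (s / p) = b ^ s := by
      intro b s
      rw [← ENNReal.rpow_mul, mul_div_cancel₀ _ hp0.ne']
    simp only [e1, ENNReal.rpow_one] at hH
    have ea : ∀ t : ℝ, ‖|t|‖ₑ = ‖t‖ₑ := fun t => enorm_norm t
    calc ∫⁻ x, ‖|H1.fn a x| ^ q * (|H1.fn v x| * |H1.fn w x|)‖ₑ
        = ∫⁻ x, ‖H1.fn a x‖ₑ ^ q * ‖H1.fn v x‖ₑ * ‖H1.fn w x‖ₑ := by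
          refine lintegral_congr fun x => ?_
          rw [enorm_mul, enorm_mul, Real.enorm_rpow_of_nonneg (abs_nonneg _) hq.le, ea, ea, ea, mul_assoc]
      _ ≤ _ := hH
      _ ≤ (ENNReal.ofReal (K * ‖a‖) ^ p) ^ (q / p) * (ENNReal.ofReal (K * ‖v‖) ^ p) ^ (1 / p)
            * (ENNReal.ofReal (K * ‖w‖) ^ p) ^ (1 / p) := by
          have := hS a
          have := hS v
          have := hS w
          gcongr
      _ = ENNReal.ofReal (K ^ p * ‖a‖ ^ q * (‖v‖ * ‖w‖)) := by
          simp only [e1, ENNReal.rpow_one]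
          rw [ENNReal.ofReal_rpow_of_nonneg (by positivity) hq.le, ← ENNReal.ofReal_mul
            (by positivity), ← ENNReal.ofReal_mul (by positivity)]
          congr 1
          rw [Real.mul_rpow hK.le (norm_nonneg _), hp, Real.rpow_add hK, Real.rpow_two]
          ring
  have hmeas : AEStronglyMeasurable
      (fun x => |H1.fn a x| ^ q * (|H1.fn v x| * |H1.fn w x|)) volume :=
    (((hm a).norm.aemeasurable.pow_const q).aestronglyMeasurable).mul
      ((hm v).norm.mul (hm w).norm)
  have hi : Integrable (fun x => |H1.fn a x| ^ q * (|H1.fn v x| * |H1.fn w x|)) :=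
    ⟨hmeas, key.trans_lt ENNReal.ofReal_lt_top⟩
  refine ⟨hi, ?_⟩
  have h0 : ∀ x, 0 ≤ |H1.fn a x| ^ q * (|H1.fn v x| * |H1.fn w x|) := fun x => by positivity
  rw [← ENNReal.ofReal_le_ofReal_iff (by positivity),
    ofReal_integral_eq_lintegral_ofReal hi (Eventually.of_forall h0)]
  refine le_trans (le_of_eq (lintegral_congr fun x => ?_)) key
  rw [Real.enorm_of_nonneg (h0 x)]

/-- Integrals of functions with subcritical growth are controlled by `H¹` norms. -/
lemma integrable_and_abs_integral_le_of_growth {N : ℕ} {q K c₁ c₂ : ℝ} (hq : 0 < q) (hK : 0 < K)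
    (hS : SobolevBound N (q + 2) K) (a b v w : H1 N) {h : RN N → ℝ}
    (hm : AEStronglyMeasurable h volume)
    (hb : ∀ᵐ x ∂(volume : Measure (RN N)), |h x| ≤
      (c₁ + c₂ * (|H1.fn a x| ^ q + |H1.fn b x| ^ q)) * (|H1.fn v x| * |H1.fn w x|))
    (hc₁ : 0 ≤ c₁) (hc₂ : 0 ≤ c₂) :
    Integrable h ∧
      |∫ x, h x| ≤ (c₁ + c₂ * K ^ (q + 2) * (‖a‖ ^ q + ‖b‖ ^ q)) * (‖v‖ * ‖w‖) := by
  obtain ⟨i0, b0⟩ := integral_abs_mul_abs_le v w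
  obtain ⟨ia, ba⟩ := integral_rpow_mul_abs_mul_abs_le hq hK hS a v w
  obtain ⟨ib, bb⟩ := integral_rpow_mul_abs_mul_abs_le hq hK hS b v w
  have hab : Integrable (fun x =>
      c₂ * (|H1.fn a x| ^ q * (|H1.fn v x| * |H1.fn w x|)) +
        c₂ * (|H1.fn b x| ^ q * (|H1.fn v x| * |H1.fn w x|))) :=
    (ia.const_mul _).add (ib.const_mul _)
  have hdom : Integrable (fun x =>
      c₁ * (|H1.fn v x| * |H1.fn w x|) +
        (c₂ * (|H1.fn a x| ^ q * (|H1.fn v x| * |H1.fn w x|)) +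
        c₂ * (|H1.fn b x| ^ q * (|H1.fn v x| * |H1.fn w x|)))) :=
    (i0.const_mul _).add hab
  have hb' : ∀ᵐ x ∂(volume : Measure (RN N)), ‖h x‖ ≤
      c₁ * (|H1.fn v x| * |H1.fn w x|) +
        (c₂ * (|H1.fn a x| ^ q * (|H1.fn v x| * |H1.fn w x|)) +
        c₂ * (|H1.fn b x| ^ q * (|H1.fn v x| * |H1.fn w x|))) := by
    filter_upwards [hb] with x hx
    rw [Real.norm_eq_abs]
    linarith
  refine ⟨hdom.mono' hm hb', ?_⟩
  rw [← Real.norm_eq_abs]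
  refine (norm_integral_le_of_norm_le hdom hb').trans ?_
  rw [integral_add (i0.const_mul _) hab,
    integral_add (ia.const_mul _) (ib.const_mul _), integral_const_mul, integral_const_mul,
    integral_const_mul]
  have h1 := mul_le_mul_of_nonneg_left b0 hc₁
  have h2 := mul_le_mul_of_nonneg_left ba hc₂
  have h3 := mul_le_mul_of_nonneg_left bb hc₂
  linarith

/-! ### Growth conditions and differentiability of integral functionals. -/

/-- A local Lipschitz condition with polynomial growth of order `q`. -/
def GrowthLipschitz (c₁ c₂ q : ℝ) (g : ℝ → ℝ) : Prop :=
  ∀ x y : ℝ, |g y - g x| ≤ (c₁ + c₂ * (|x| ^ q + |y| ^ q)) * |y - x|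

lemma GrowthLipschitz.continuous {c₁ c₂ q : ℝ} (hq : 0 < q) {g : ℝ → ℝ}
    (hg : GrowthLipschitz c₁ c₂ q g) : Continuous g := by
  refine continuous_iff_continuousAt.2 fun x => ?_
  rw [ContinuousAt, tendsto_iff_norm_sub_tendsto_zero]
  have hc : Continuous fun y : ℝ => (c₁ + c₂ * (|x| ^ q + |y| ^ q)) * |y - x| := by
    have : Continuous fun y : ℝ => |y| ^ q := continuous_abs.rpow_const fun _ => Or.inr hq.le
    fun_prop
  refine squeeze_zero (fun _ => norm_nonneg _) (fun y => hg x y) ?_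
  have := hc.tendsto x
  simpa using this

/-- The remainder is the integral of g(t) - g(x) for t between x and y, where |t|^q ≤ |x|^q + |y|^q;
this accounts for the factor 2. It acts as a second-order Taylor bound although g is only locally
Lipschitz. -/
lemma primF_sub_sub_le {c₁ c₂ q : ℝ} (hq : 0 < q) (hc₁ : 0 ≤ c₁) (hc₂ : 0 ≤ c₂) {g : ℝ → ℝ}
    (hg : GrowthLipschitz c₁ c₂ q g) (x y : ℝ) :
    |primF g y - primF g x - g x * (y - x)| ≤
      (c₁ + 2 * c₂ * (|x| ^ q + |y| ^ q)) * (|y - x| * |y - x|) := by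
  have hgc := hg.continuous hq
  have hi : ∀ s t : ℝ, IntervalIntegrable g volume s t := fun s t => hgc.intervalIntegrable s t
  have e : primF g y - primF g x - g x * (y - x) = ∫ t in x..y, (g t - g x) := by
    rw [intervalIntegral.integral_sub (hi x y) (by simp), intervalIntegral.integral_const,
      primF, primF, intervalIntegral.integral_interval_sub_left (hi 0 y) (hi 0 x), smul_eq_mul]
    ring
  rw [e, ← mul_assoc, ← Real.norm_eq_abs]
  refine intervalIntegral.norm_integral_le_of_norm_le_const fun t ht => ?_
  have ht' := uIoc_subset_uIcc ht
  have h1 : |t - x| ≤ |y - x| := abs_sub_left_of_mem_uIcc ht'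
  have h2 : |t| ≤ max |x| |y| := by
    rcases mem_uIcc.1 ht' with h | h
    · exact abs_le_max_abs_abs h.1 h.2
    · rw [max_comm]
      exact abs_le_max_abs_abs h.1 h.2
  have h3 : |t| ^ q ≤ |x| ^ q + |y| ^ q := by
    have hx := Real.rpow_nonneg (abs_nonneg x) q
    have hy := Real.rpow_nonneg (abs_nonneg y) q
    rcases le_max_iff.1 h2 with h | h
    · linarith [Real.rpow_le_rpow (abs_nonneg t) h hq.le]
    · linarith [Real.rpow_le_rpow (abs_nonneg t) h hq.le]
  have hy := Real.rpow_nonneg (abs_nonneg y) q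
  refine (hg x t).trans (mul_le_mul ?_ h1 (abs_nonneg _) (by positivity))
  nlinarith

lemma hasFDerivAt_of_abs_sub_sub_le {E : Type*} [NormedAddCommGroup E] [NormedSpace ℝ E]
    {φ : E → ℝ} {L : E →L[ℝ] ℝ} {u : E} {M : ℝ}
    (h : ∀ v, ‖v‖ < 1 → |φ (u + v) - φ u - L v| ≤ M * (‖v‖ * ‖v‖)) : HasFDerivAt φ L u := by
  rw [hasFDerivAt_iff_isLittleO_nhds_zero]
  refine IsBigO.trans_isLittleO (g := fun v : E => ‖v‖ ^ 2) (IsBigO.of_bound M ?_)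
    (isLittleO_norm_pow_id one_lt_two)
  filter_upwards [Metric.ball_mem_nhds (0 : E) one_pos] with v hv
  rw [norm_pow, norm_norm, sq]
  exact h v (mem_ball_zero_iff.1 hv)

/-- The functional `u ↦ ∫ G(u)`, `G' = g`, is of class `C¹` on `H¹(ℝ^N)` when `g` has subcritical
growth, and its derivative at `u` is `v ↦ ∫ g(u) v`. -/
lemma exists_fderiv_integral_primF {N : ℕ} {q K c₁ c₂ : ℝ} (hq : 0 < q) (hK : 0 < K)
    (hS : SobolevBound N (q + 2) K) (hc₁ : 0 ≤ c₁) (hc₂ : 0 ≤ c₂) {g : ℝ → ℝ}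
    (hg : GrowthLipschitz c₁ c₂ q g) (hg0 : g 0 = 0) :
    (∀ u : H1 N, Integrable fun x => primF g (H1.fn u x)) ∧
    (∀ u v : H1 N, Integrable fun x => g (H1.fn u x) * H1.fn v x) ∧
    ∃ D : H1 N → H1 N →L[ℝ] ℝ, Continuous D ∧
      (∀ u v, D u v = ∫ x, g (H1.fn u x) * H1.fn v x) ∧
      ∀ u, HasFDerivAt (fun u : H1 N => ∫ x, primF g (H1.fn u x)) (D u) u := by
  have hgc := hg.continuous hq
  have hFc : Continuous (primF g) := by
    refine continuous_iff_continuousAt.2 fun x => ?_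
    exact (intervalIntegral.integral_hasDerivAt_right (hgc.intervalIntegrable 0 x)
      hgc.aestronglyMeasurable.stronglyMeasurableAtFilter hgc.continuousAt).continuousAt
  have hm : ∀ u : H1 N, AEStronglyMeasurable (H1.fn u) volume := fun u => (H1.memLp_fn u).1
  have hgm : ∀ u : H1 N, AEStronglyMeasurable (fun x => g (H1.fn u x)) volume :=
    fun u => hgc.comp_aestronglyMeasurable (hm u)
  have hFm : ∀ u : H1 N, AEStronglyMeasurable (fun x => primF g (H1.fn u x)) volume :=
    fun u => hFc.comp_aestronglyMeasurable (hm u)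
  have hFi : ∀ u : H1 N, Integrable fun x => primF g (H1.fn u x) := fun u => by
    refine (integrable_and_abs_integral_le_of_growth hq hK hS u u u u (hFm u) (c₁ := c₁)
      (c₂ := 2 * c₂) (Eventually.of_forall fun x => ?_) hc₁ (by positivity)).1
    -- Expansion at 0, where both `g` and its primitive vanish, bounds the primitive itself.
    have h := primF_sub_sub_le hq hc₁ hc₂ hg 0 (H1.fn u x)
    have h0 : primF g 0 = 0 := intervalIntegral.integral_same
    rw [h0, hg0] at h
    simp only [sub_zero, zero_mul, abs_zero, Real.zero_rpow hq.ne'] at h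
    refine h.trans (mul_le_mul_of_nonneg_right ?_ (by positivity))
    have := Real.rpow_nonneg (abs_nonneg (H1.fn u x)) q
    nlinarith
  have hDi : ∀ u v : H1 N, Integrable (fun x => g (H1.fn u x) * H1.fn v x) ∧
      |∫ x, g (H1.fn u x) * H1.fn v x| ≤
        (c₁ + c₂ * K ^ (q + 2) * (‖u‖ ^ q + ‖u‖ ^ q)) * (‖u‖ * ‖v‖) := fun u v => by
    refine integrable_and_abs_integral_le_of_growth hq hK hS u u u v ((hgm u).mul (hm v))
      (Eventually.of_forall fun x => ?_) hc₁ hc₂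
    have h := hg 0 (H1.fn u x)
    simp only [hg0, sub_zero, abs_zero, Real.zero_rpow hq.ne'] at h
    rw [abs_mul, ← mul_assoc]
    refine mul_le_mul_of_nonneg_right (h.trans (mul_le_mul_of_nonneg_right ?_ (abs_nonneg _)))
      (abs_nonneg _)
    have := Real.rpow_nonneg (abs_nonneg (H1.fn u x)) q
    nlinarith
  have hex : ∀ u : H1 N, ∃ L : H1 N →L[ℝ] ℝ, ∀ v, L v = ∫ x, g (H1.fn u x) * H1.fn v x := by
    intro u
    let L : H1 N →ₗ[ℝ] ℝ :=
      { toFun := fun v => ∫ x, g (H1.fn u x) * H1.fn v x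
        map_add' := fun v w => by
          rw [← integral_add (hDi u v).1 (hDi u w).1]
          refine integral_congr_ae ?_
          filter_upwards [H1.coeFn_fn_add v w] with x hx
          rw [hx, mul_add]
        map_smul' := fun c v => by
          rw [RingHom.id_apply, smul_eq_mul, ← integral_const_mul]
          refine integral_congr_ae ?_
          filter_upwards [H1.coeFn_fn_smul c v] with x hx
          rw [hx]
          ring }
    have hL : ∀ v, ‖L v‖ ≤ ((c₁ + c₂ * K ^ (q + 2) * (‖u‖ ^ q + ‖u‖ ^ q)) * ‖u‖) * ‖v‖ :=
      fun v => (Real.norm_eq_abs _).trans_le ((hDi u v).2.trans_eq (mul_assoc _ _ _).symm)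
    exact ⟨L.mkContinuous _ hL, fun v => rfl⟩
  choose D hD using hex
  refine ⟨hFi, fun u v => (hDi u v).1, D, ?_, hD, fun u => ?_⟩
  · refine continuous_iff_continuousAt.2 fun u => ?_
    refine (tendsto_iff_norm_sub_tendsto_zero (f := D) (b := D u)).2 ?_
    -- The two powers in `GrowthLipschitz` serve here: the increment of `g` between `u` and `w` is
    -- estimated against an arbitrary direction `v`.
    have hb : ∀ w, ‖D w - D u‖ ≤
        (c₁ + c₂ * K ^ (q + 2) * (‖u‖ ^ q + ‖w‖ ^ q)) * ‖w - u‖ := by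
      intro w
      refine ContinuousLinearMap.opNorm_le_bound _ (by positivity) fun v => ?_
      rw [sub_apply, hD, hD, ← integral_sub (hDi w v).1 (hDi u v).1,
        mul_assoc, Real.norm_eq_abs]
      refine (integrable_and_abs_integral_le_of_growth hq hK hS u w (w - u) v
        (h := fun x => g (H1.fn w x) * H1.fn v x - g (H1.fn u x) * H1.fn v x)
        (((hgm w).mul (hm v)).sub ((hgm u).mul (hm v))) ?_ hc₁ hc₂).2
      filter_upwards [H1.coeFn_fn_add (w - u) u] with x hx
      rw [sub_add_cancel] at hx
      have hx' : H1.fn (w - u) x = H1.fn w x - H1.fn u x := by linarith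
      rw [← sub_mul, abs_mul, hx', ← mul_assoc]
      exact mul_le_mul_of_nonneg_right (hg _ _) (abs_nonneg _)
    refine squeeze_zero (fun w => norm_nonneg (D w - D u)) hb ?_
    have hc : Continuous fun w : H1 N =>
        (c₁ + c₂ * K ^ (q + 2) * (‖u‖ ^ q + ‖w‖ ^ q)) * ‖w - u‖ := by
      have : Continuous fun w : H1 N => ‖w‖ ^ q :=
        continuous_norm.rpow_const fun _ => Or.inr hq.le
      fun_prop
    simpa using hc.tendsto u
  -- Restricting to ‖v‖ < 1 replaces ‖u + v‖ by ‖u‖ + 1 and makes the constant independent of `v`.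
  · refine hasFDerivAt_of_abs_sub_sub_le
      (M := c₁ + 2 * c₂ * K ^ (q + 2) * (‖u‖ ^ q + (‖u‖ + 1) ^ q)) fun v hv => ?_
    have hsub : Integrable fun x => primF g (H1.fn (u + v) x) - primF g (H1.fn u x) :=
      (hFi _).sub (hFi _)
    rw [hD, ← integral_sub (hFi _) (hFi _), ← integral_sub hsub (hDi u v).1]
    have hrem := (integrable_and_abs_integral_le_of_growth hq hK hS u (u + v) v v
      (h := fun x => primF g (H1.fn (u + v) x) - primF g (H1.fn u x) - g (H1.fn u x) * H1.fn v x)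
      (((hFm _).sub (hFm _)).sub ((hgm u).mul (hm v))) (c₁ := c₁)
      (c₂ := 2 * c₂) (by
        filter_upwards [H1.coeFn_fn_add u v] with x hx
        have h := primF_sub_sub_le hq hc₁ hc₂ hg (H1.fn u x) (H1.fn (u + v) x)
        have hx' : H1.fn (u + v) x - H1.fn u x = H1.fn v x := by linarith
        rwa [hx'] at h) hc₁ (by positivity)).2
    have hn : ‖u + v‖ ≤ ‖u‖ + 1 := (norm_add_le u v).trans (by linarith)
    have hn0 : 0 ≤ ‖u + v‖ := norm_nonneg _
    have hv0 : 0 ≤ ‖v‖ := norm_nonneg _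
    refine hrem.trans ?_
    generalize ‖u + v‖ = s at hn hn0 ⊢
    generalize ‖u‖ = t at hn ⊢
    generalize ‖v‖ = r at hv0 ⊢
    have h := Real.rpow_le_rpow hn0 hn hq.le
    have hc : 0 ≤ 2 * c₂ * K ^ (q + 2) := by positivity
    exact mul_le_mul_of_nonneg_right (add_le_add le_rfl
      (mul_le_mul_of_nonneg_left (add_le_add le_rfl h) hc)) (mul_nonneg hv0 hv0)

/-! ### Regular level sets, and completeness of `H1`. -/

/-- Regular level sets of `C¹` functions, intersected with an open set, are hypersurfaces. -/
lemma isC1Hypersurface_of_contDiff {E : Type*} [NormedAddCommGroup E] [NormedSpace ℝ E]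
    [CompleteSpace E] {J : E → ℝ} (hJ : ContDiff ℝ 1 J) {U : Set E} (hU : IsOpen U) {S : Set E}
    (hS : ∀ x, x ∈ S ↔ x ∈ U ∧ J x = 0) (hreg : ∀ x ∈ S, ∃ e, fderiv ℝ J x e ≠ 0) :
    IsC1Hypersurface S := by
  intro x hx
  obtain ⟨e₀, he₀⟩ := hreg x hx
  set ℓ : E →L[ℝ] ℝ := fderiv ℝ J x with hℓ
  set e : E := (ℓ e₀)⁻¹ • e₀ with he
  have hℓe : ℓ e = 1 := by rw [he, map_smul, smul_eq_mul, inv_mul_cancel₀ he₀]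
  -- This map straightens `J`: since ℓ(e) = 1, one has ℓ ∘ Ψ = J, and the derivative of Ψ at `x` is
  -- the identity.
  let Ψ : E → E := fun w => w + (J w - ℓ w) • e
  have hΨ : ContDiff ℝ 1 Ψ :=
    contDiff_id.add ((hJ.sub ℓ.contDiff).smul contDiff_const)
  have hℓΨ : ∀ w, ℓ (Ψ w) = J w := fun w => by
    simp only [Ψ, map_add, map_smul, hℓe, smul_eq_mul]
    ring
  have hder : HasFDerivAt Ψ ((ContinuousLinearEquiv.refl ℝ E : E ≃L[ℝ] E) : E →L[ℝ] E) x := by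
    have h1 : HasFDerivAt J ℓ x := (hJ.differentiable (by simp)).differentiableAt.hasFDerivAt
    have h2 := (hasFDerivAt_id x).add ((h1.sub ℓ.hasFDerivAt).smul_const e)
    refine h2.congr_fderiv ?_
    ext v
    simp
  let Φ₀ := (hΨ.contDiffAt (x := x)).toOpenPartialHomeomorph Ψ hder one_ne_zero
  have hx₀ : x ∈ Φ₀.source := (hΨ.contDiffAt).mem_toOpenPartialHomeomorph_source hder one_ne_zero
  have hΨd : Continuous (fderiv ℝ Ψ) := hΨ.continuous_fderiv (by simp)
  -- Shrinking to points where the derivative of Ψ is invertible makes the inverse C¹ on the whole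
  -- target, not only at the image of `x`.
  let W : Set E := U ∩ fderiv ℝ Ψ ⁻¹' range ((↑) : (E ≃L[ℝ] E) → E →L[ℝ] E)
  have hW : IsOpen W := hU.inter ((ContinuousLinearEquiv.isOpen (E := E) (F := E)).preimage hΨd)
  have hxW : x ∈ W := ⟨((hS x).1 hx).1, ContinuousLinearEquiv.refl ℝ E, hder.fderiv.symm⟩
  let Φ := Φ₀.restrOpen W hW
  have hΦ : ∀ w, Φ w = Ψ w := fun w => rfl
  have hsrc : Φ.source = Φ₀.source ∩ W := rfl
  refine ⟨Φ, LinearMap.ker (ℓ : E →ₗ[ℝ] ℝ), ⟨hx₀, hxW⟩, hΨ.contDiffOn, ?_, ?_, ?_, ?_⟩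
  · intro y hy
    have hmem : Φ.symm y ∈ Φ.source := Φ.map_target hy
    obtain ⟨L, hL⟩ := hmem.2.2
    refine (Φ.contDiffAt_symm (f₀' := L) hy ?_ hΨ.contDiffAt).contDiffWithinAt
    rw [hL]
    exact (hΨ.differentiable (by simp)).differentiableAt.hasFDerivAt
  · exact ℓ.isClosed_ker
  · have hsurj : Function.Surjective (ℓ : E →ₗ[ℝ] ℝ) := fun t => ⟨t • e, by simp [hℓe]⟩
    rw [((ℓ : E →ₗ[ℝ] ℝ).quotKerEquivOfSurjective hsurj).finrank_eq, Module.finrank_self]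
  · ext y
    constructor
    · rintro ⟨w, ⟨hwS, hw⟩, rfl⟩
      refine ⟨?_, Φ.map_source hw⟩
      change ℓ (Φ w) = 0
      rw [hΦ, hℓΨ]
      exact ((hS w).1 hwS).2
    · rintro ⟨hyV, hy⟩
      have hmem : Φ.symm y ∈ Φ.source := Φ.map_target hy
      refine ⟨Φ.symm y, ⟨(hS _).2 ⟨hmem.2.1, ?_⟩, hmem⟩, Φ.right_inv hy⟩
      rw [← hℓΨ, ← hΦ, Φ.right_inv hy]
      exact hyV

/-- Each weak-gradient identity equates two continuous functions on `L2Pair N`, namely pairings with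
fixed L² functions. The resulting completeness of `H1 N` is needed for the inverse function theorem.
-/
lemma H1.isClosed (N : ℕ) : IsClosed (H1 N : Set (L2Pair N)) := by
  have hset : (H1 N : Set (L2Pair N)) = ⋂ (φ : RN N → ℝ) (h : ContDiff ℝ ∞ φ)
      (hc : HasCompactSupport φ) (i : Fin N),
      {w : L2Pair N | inner ℝ ((memLp_test_deriv h hc (EuclideanSpace.single i 1)).toLp) w.fst =
        - inner ℝ ((memLp_test h hc).toLp)
          ((EuclideanSpace.proj i : RN N →L[ℝ] ℝ).compLp w.snd)} := by
    ext w
    simp only [mem_iInter, mem_ofPred_eq]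
    refine forall_congr' fun φ => forall_congr' fun h => forall_congr' fun hc =>
      forall_congr' fun i => ?_
    have h1 : inner ℝ ((memLp_test_deriv h hc (EuclideanSpace.single i 1)).toLp) w.fst =
        ∫ x, w.fst x * fderiv ℝ φ x (EuclideanSpace.single i 1) := by
      rw [L2.inner_def]
      refine integral_congr_ae ?_
      filter_upwards [(memLp_test_deriv h hc (EuclideanSpace.single i 1)).coeFn_toLp] with x hx
      simp [hx]
    have h2 : inner ℝ ((memLp_test h hc).toLp)
        ((EuclideanSpace.proj i : RN N →L[ℝ] ℝ).compLp w.snd) = ∫ x, w.snd x i * φ x := by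
      rw [L2.inner_def]
      refine integral_congr_ae ?_
      filter_upwards [(memLp_test h hc).coeFn_toLp,
        (EuclideanSpace.proj i : RN N →L[ℝ] ℝ).coeFn_compLp w.snd] with x hx hx'
      simp [hx, hx']
    rw [h1, h2]
  rw [hset]
  refine isClosed_iInter fun φ => isClosed_iInter fun h => isClosed_iInter fun hc =>
    isClosed_iInter fun i => isClosed_eq ?_ ?_
  · exact continuous_const.inner (WithLp.continuous_fst 2 _ _)
  · refine (continuous_const.inner ?_).neg
    exact ((EuclideanSpace.proj i : RN N →L[ℝ] ℝ).compLpL 2 volume).continuous.comp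
      (WithLp.continuous_snd 2 _ _)

instance H1.completeSpace (N : ℕ) : CompleteSpace (H1 N) :=
  (H1.isClosed N).completeSpace_coe

/-! ### The nonlinearity and its primitive. -/

/-- The mean value inequality on [0, max(|x|, |y|)] handles equal signs, using oddness on the
negative side. For opposite signs the comparison passes through f(0) = 0, and nothing is lost
because |y - x| = |x| + |y|. -/
lemma growthLipschitz_of_odd {f : ℝ → ℝ} {a₁ a₂ q : ℝ} (hq : 0 < q) (ha₂ : 0 ≤ a₂)
    (hodd : Function.Odd f) (hf : ContDiffOn ℝ 1 f (Ici 0))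
    (hd : ∀ u : ℝ, 0 ≤ u → |derivWithin f (Ici 0) u| ≤ a₁ + a₂ * |u| ^ q) :
    GrowthLipschitz a₁ a₂ q f := by
  intro x y
  set M : ℝ := max |x| |y| with hM
  set C : ℝ := a₁ + a₂ * (|x| ^ q + |y| ^ q) with hC
  have hM0 : 0 ≤ M := le_max_of_le_left (abs_nonneg x)
  have hLip : ∀ s ∈ Icc 0 M, ∀ t ∈ Icc 0 M, |f t - f s| ≤ C * |t - s| := by
    intro s hs t ht
    refine (convex_Icc 0 M).norm_image_sub_le_of_norm_hasDerivWithin_le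
      (f' := derivWithin f (Ici 0)) (fun z hz => ?_) (fun z hz => ?_) hs ht
    · exact ((hf.differentiableOn (by simp)) z hz.1).hasDerivWithinAt.mono Icc_subset_Ici_self
    · have hz' : |z| ≤ M := by rw [abs_of_nonneg hz.1]; exact hz.2
      have hx := Real.rpow_nonneg (abs_nonneg x) q
      have hy := Real.rpow_nonneg (abs_nonneg y) q
      have h3 : |z| ^ q ≤ |x| ^ q + |y| ^ q := by
        rcases le_max_iff.1 hz' with h | h
        · linarith [Real.rpow_le_rpow (abs_nonneg z) h hq.le]
        · linarith [Real.rpow_le_rpow (abs_nonneg z) h hq.le]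
      rw [Real.norm_eq_abs]
      exact (hd z hz.1).trans (add_le_add le_rfl (mul_le_mul_of_nonneg_left h3 ha₂))
  have h0 : (0 : ℝ) ∈ Icc 0 M := ⟨le_rfl, hM0⟩
  have hf0 : f 0 = 0 := hodd.map_zero
  have hxM : |x| ∈ Icc 0 M := ⟨abs_nonneg x, le_max_left _ _⟩
  have hyM : |y| ∈ Icc 0 M := ⟨abs_nonneg y, le_max_right _ _⟩
  have hxy := hLip _ hxM _ hyM
  have hx := hLip _ h0 _ hxM
  have hy := hLip _ h0 _ hyM
  rw [hf0, sub_zero, sub_zero, abs_abs] at hx hy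
  rcases le_total 0 x with h1 | h1 <;> rcases le_total 0 y with h2 | h2
  · rwa [abs_of_nonneg h1, abs_of_nonneg h2] at hxy
  · rw [abs_of_nonneg h1] at hx
    rw [abs_of_nonpos h2, hodd, abs_neg] at hy
    rw [abs_of_nonpos (by linarith : y - x ≤ 0)]
    linarith [abs_sub (f y) (f x)]
  · rw [abs_of_nonpos h1, hodd, abs_neg] at hx
    rw [abs_of_nonneg h2] at hy
    rw [abs_of_nonneg (by linarith : 0 ≤ y - x)]
    linarith [abs_sub (f y) (f x)]
  · rw [abs_of_nonpos h1, abs_of_nonpos h2, hodd, hodd] at hxy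
    have e1 : -f y - -f x = -(f y - f x) := by ring
    have e2 : -y - -x = -(y - x) := by ring
    rwa [e1, e2, abs_neg, abs_neg] at hxy

lemma GrowthLipschitz.sub_const_mul {c₁ c₂ q lam : ℝ} (hlam : 0 ≤ lam) {f : ℝ → ℝ}
    (hf : GrowthLipschitz c₁ c₂ q f) :
    GrowthLipschitz (c₁ + lam) c₂ q fun t => f t - lam * t := by
  intro x y
  have e : f y - lam * y - (f x - lam * x) = (f y - f x) - lam * (y - x) := by ring
  have h : |lam * (y - x)| = lam * |y - x| := by rw [abs_mul, abs_of_nonneg hlam]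
  calc |f y - lam * y - (f x - lam * x)| ≤ |f y - f x| + |lam * (y - x)| := by
        rw [e]
        exact abs_sub _ _
    _ ≤ (c₁ + c₂ * (|x| ^ q + |y| ^ q)) * |y - x| + lam * |y - x| := by
        rw [h]
        exact add_le_add (hf x y) le_rfl
    _ = _ := by ring

/-- Absorbs λ into the nonlinearity, so that the results on primitives apply to G. -/
lemma primF_sub_const_mul {f : ℝ → ℝ} (hf : Continuous f) (lam s : ℝ) :
    primF (fun t => f t - lam * t) s = potG lam f s := by
  have h1 : IntervalIntegrable (fun t => lam * t) volume 0 s :=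
    (continuous_const.mul continuous_id).intervalIntegrable 0 s
  rw [primF, intervalIntegral.integral_sub (hf.intervalIntegrable 0 s) h1,
    intervalIntegral.integral_const_mul, integral_id, potG, primF]
  ring

/-- A function of subcritical growth that is `o(u)` at `0` has a primitive bounded by
`ε s² + C |s|^(q+2)`. -/
lemma exists_abs_primF_le {c₁ c₂ q : ℝ} (hq : 0 < q) (hc₁ : 0 ≤ c₁) (hc₂ : 0 ≤ c₂) {f : ℝ → ℝ}
    (hg : GrowthLipschitz c₁ c₂ q f) (hf0 : f 0 = 0) (hf : f =o[𝓝 0] (fun u : ℝ => u))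
    {ε : ℝ} (hε : 0 < ε) :
    ∃ C : ℝ, 0 < C ∧ ∀ s, |primF f s| ≤ (ε + C * |s| ^ q) * (|s| * |s|) := by
  obtain ⟨δ, hδ, hδf⟩ := Metric.eventually_nhds_iff.1 (hf.bound hε)
  have hδq : 0 < δ ^ q := Real.rpow_pos_of_pos hδ q
  -- For |s| ≥ δ the constant `c₁` is absorbed as c₁ ≤ (c₁/δ^q)|s|^q; for |s| < δ the `o(u)`
  -- condition suffices. The summand 1 only ensures positivity.
  have hC : 0 < c₁ / δ ^ q + c₂ + 1 := by positivity
  have hbound : ∀ s, |f s| ≤ (ε + (c₁ / δ ^ q + c₂ + 1) * |s| ^ q) * |s| := by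
    intro s
    have hs := Real.rpow_nonneg (abs_nonneg s) q
    rcases lt_or_ge |s| δ with h | h
    · have := hδf (y := s) (by rwa [Real.dist_eq, sub_zero])
      rw [Real.norm_eq_abs, Real.norm_eq_abs] at this
      have h2 : 0 ≤ (c₁ / δ ^ q + c₂ + 1) * |s| ^ q * |s| := by positivity
      linarith
    · have h1 := hg 0 s
      rw [hf0, sub_zero, sub_zero, abs_zero, Real.zero_rpow hq.ne', zero_add] at h1
      refine h1.trans (mul_le_mul_of_nonneg_right ?_ (abs_nonneg s))
      have h2 : δ ^ q ≤ |s| ^ q := Real.rpow_le_rpow hδ.le h hq.le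
      have h3 : c₁ ≤ c₁ / δ ^ q * |s| ^ q := by
        rw [div_mul_eq_mul_div, le_div_iff₀ hδq]
        exact mul_le_mul_of_nonneg_left h2 hc₁
      nlinarith
  refine ⟨_, hC, fun s => ?_⟩
  have hle : ∀ t ∈ uIoc 0 s, ‖f t‖ ≤ (ε + (c₁ / δ ^ q + c₂ + 1) * |s| ^ q) * |s| := by
    intro t ht
    have hts : |t| ≤ |s| := by
      simpa using abs_sub_left_of_mem_uIcc (uIoc_subset_uIcc ht)
    have := Real.rpow_le_rpow (abs_nonneg t) hts hq.le
    refine (hbound t).trans ?_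
    gcongr
  have := intervalIntegral.norm_integral_le_of_norm_le_const hle
  rw [sub_zero, mul_assoc] at this
  exact this

/-! ### The Pohozaev functional. -/

lemma integral_norm_sq_eq {N : ℕ} {V : Type*} [NormedAddCommGroup V] [InnerProductSpace ℝ V]
    (h : Lp V 2 (volume : Measure (RN N))) : ∫ x, ‖h x‖ ^ 2 = ‖h‖ ^ 2 := by
  rw [← real_inner_self_eq_norm_sq, L2.inner_def]
  simp

lemma H1.norm_sq_eq_add {N : ℕ} (u : H1 N) : ‖u‖ ^ 2 = ‖H1.fn u‖ ^ 2 + ‖H1.grad u‖ ^ 2 :=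
  WithLp.prod_norm_sq_eq_of_L2 u.1

/-- The weak gradient as a continuous linear map on `H¹(ℝ^N)`. -/
noncomputable def H1.gradL (N : ℕ) : H1 N →L[ℝ] Lp (RN N) 2 (volume : Measure (RN N)) :=
  (WithLp.sndL 2 ℝ _ _).comp (H1 N).subtypeL

lemma H1.gradL_apply {N : ℕ} (u : H1 N) : H1.gradL N u = H1.grad u := rfl

lemma contDiff_pohozaevJ_aux {N : ℕ} {κ : ℝ} {ψ : H1 N → ℝ} {D : H1 N → H1 N →L[ℝ] ℝ}
    (hD : Continuous D) (hψ : ∀ u, HasFDerivAt ψ (D u) u) {J : H1 N → ℝ}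
    (hJ : ∀ u, J u = ‖H1.grad u‖ ^ 2 - κ * ψ u) :
    ContDiff ℝ 1 J ∧ ∀ u, fderiv ℝ J u u = 2 * ‖H1.grad u‖ ^ 2 - κ * D u u := by
  have hJ' : J = fun u => ‖H1.gradL N u‖ ^ 2 - κ * ψ u := funext hJ
  refine ⟨?_, fun u => ?_⟩
  · rw [hJ']
    exact ((H1.gradL N).contDiff.norm_sq ℝ).sub
      (contDiff_const.mul (contDiff_one_iff_hasFDerivAt.2 ⟨D, hD, hψ⟩))
  · have h := ((H1.gradL N).hasFDerivAt (x := u)).norm_sq.sub ((hψ u).const_mul κ)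
    rw [hJ']
    refine (congrArg (fun T : H1 N →L[ℝ] ℝ => T u) h.fderiv).trans ?_
    simp [H1.gradL_apply]

/-- The zero set of the Pohozaev functional stays away from the origin. -/
lemma exists_pos_lt_norm_of_mem_pohozaevManifold {N : ℕ} (hN : 3 ≤ N) {lam q K c₁ c₂ : ℝ}
    (hlam : 0 < lam) {f : ℝ → ℝ} (hq : 0 < q) (hK : 0 < K) (hS : SobolevBound N (q + 2) K)
    (hc₁ : 0 ≤ c₁) (hc₂ : 0 ≤ c₂) (hf : GrowthLipschitz c₁ c₂ q f) (hf0 : f 0 = 0)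
    (hfo : f =o[𝓝 0] (fun u : ℝ => u)) :
    ∃ σ : ℝ, 0 < σ ∧ ∀ u ∈ pohozaevManifold N lam f, σ < ‖u‖ := by
  have hN' : (3 : ℝ) ≤ N := by exact_mod_cast hN
  set κ : ℝ := 2 * (N : ℝ) / ((N : ℝ) - 2) with hκ
  have hκ0 : 0 < κ := div_pos (by linarith) (by linarith)
  set m : ℝ := min 1 (κ * (lam / 2)) with hm
  have hm0 : 0 < m := lt_min one_pos (by positivity)
  -- After multiplication by κ, this ε costs half of the coercivity constant `m`.
  obtain ⟨C, hC, hF⟩ := exists_abs_primF_le hq hc₁ hc₂ hf hf0 hfo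
    (ε := m / (2 * κ)) (by positivity)
  obtain ⟨hFi, -⟩ := exists_fderiv_integral_primF hq hK hS hc₁ hc₂ hf hf0
  have hB : 0 < 8 * κ * C * K ^ (q + 2) := by positivity
  -- Below this radius the superquadratic term 2κCK^(q+2)‖u‖^q is at most m/4, so the total 3m/4
  -- stays below `m`.
  refine ⟨(m / (8 * κ * C * K ^ (q + 2))) ^ q⁻¹, by positivity, fun u hu => ?_⟩
  obtain ⟨hu0, hJ⟩ := hu
  by_contra! hle
  have hu1 : 0 < ‖u‖ := norm_pos_iff.2 hu0
  have huq : ‖u‖ ^ q * (8 * κ * C * K ^ (q + 2)) ≤ m := by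
    have := Real.rpow_le_rpow hu1.le hle hq.le
    rwa [← Real.rpow_mul (by positivity), inv_mul_cancel₀ hq.ne', Real.rpow_one,
      le_div_iff₀ hB] at this
  have hFint := (integrable_and_abs_integral_le_of_growth hq hK hS u u u u (hFi u).1
    (c₁ := m / (2 * κ)) (c₂ := C) (Eventually.of_forall fun x => by
      refine (hF _).trans (mul_le_mul_of_nonneg_right ?_ (by positivity))
      have := mul_nonneg hC.le (Real.rpow_nonneg (abs_nonneg (H1.fn u x)) q)
      linarith) (by positivity) hC.le).2
  have hsq : Integrable fun x => -(lam / 2) * (H1.fn u x) ^ 2 :=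
    (H1.memLp_fn u).integrable_sq.const_mul _
  have hsqn : ∫ x, (H1.fn u x) ^ 2 = ‖H1.fn u‖ ^ 2 := by
    rw [← integral_norm_sq_eq]
    simp
  have hJe : ‖H1.grad u‖ ^ 2 + κ * (lam / 2) * ‖H1.fn u‖ ^ 2 =
      κ * ∫ x, primF f (H1.fn u x) := by
    rw [pohozaevJ, integral_norm_sq_eq] at hJ
    simp only [potG] at hJ
    rw [integral_add hsq (hFi u), integral_const_mul, hsqn] at hJ
    linarith
  have hlow : m * ‖u‖ ^ 2 ≤ ‖H1.grad u‖ ^ 2 + κ * (lam / 2) * ‖H1.fn u‖ ^ 2 := by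
    rw [H1.norm_sq_eq_add]
    have h1 := mul_le_mul_of_nonneg_right (min_le_left 1 (κ * (lam / 2))) (sq_nonneg ‖H1.grad u‖)
    have h2 := mul_le_mul_of_nonneg_right (min_le_right 1 (κ * (lam / 2))) (sq_nonneg ‖H1.fn u‖)
    rw [← hm] at h1 h2
    linarith
  have hup : κ * ∫ x, primF f (H1.fn u x) ≤
      (m / 2 + κ * (C * K ^ (q + 2) * (‖u‖ ^ q + ‖u‖ ^ q))) * ‖u‖ ^ 2 := by
    have h1 := mul_le_mul_of_nonneg_left ((le_abs_self _).trans hFint) hκ0.le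
    refine h1.trans_eq ?_
    field_simp
  have hfin : m * ‖u‖ ^ 2 ≤ (m / 2 + m / 4) * ‖u‖ ^ 2 := by
    refine (hlow.trans (hJe.trans_le hup)).trans
      (mul_le_mul_of_nonneg_right ?_ (sq_nonneg _))
    linarith
  nlinarith [mul_pos hm0 (pow_pos hu1 2)]

lemma primF_even {f : ℝ → ℝ} (hodd : Function.Odd f) (s : ℝ) : primF f (-s) = primF f s := by
  have h := intervalIntegral.integral_comp_neg (f := f) (a := 0) (b := s)
  simp only [hodd _, intervalIntegral.integral_neg, neg_zero] at h
  rw [primF, primF, intervalIntegral.integral_symm, ← h, neg_neg]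

/-- The derivative of the Pohozaev functional is negative in the radial direction. -/
lemma pohozaev_radial_deriv_neg {N : ℕ} {lam : ℝ} {f : ℝ → ℝ} (hodd : Function.Odd f)
    {κ : ℝ} (hκ : 0 < κ)
    (hpos : ∀ u : ℝ, 0 < u → 0 < 1 / 2 * f u * u - primF f u) {u : H1 N} (hu : u ≠ 0)
    (hGi : Integrable fun x => potG lam f (H1.fn u x))
    (hgi : Integrable fun x => (f (H1.fn u x) - lam * H1.fn u x) * H1.fn u x)
    (hJ : ‖H1.grad u‖ ^ 2 - κ * ∫ x, potG lam f (H1.fn u x) = 0) :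
    2 * ‖H1.grad u‖ ^ 2 - κ * ∫ x, (f (H1.fn u x) - lam * H1.fn u x) * H1.fn u x < 0 := by
  set H : ℝ → ℝ := fun s => 1 / 2 * f s * s - primF f s with hH
  have hF0 : primF f 0 = 0 := intervalIntegral.integral_same
  have hHne : ∀ s, s ≠ 0 → 0 < H s := by
    intro s hs
    rcases hs.lt_or_gt with h | h
    · have := hpos (-s) (by linarith)
      rw [hodd, primF_even hodd] at this
      simp only [hH]
      linarith
    · exact hpos s h
  have hHnn : ∀ s, 0 ≤ H s := by
    intro s
    rcases eq_or_ne s 0 with rfl | hs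
    · simp [hH, hF0]
    · exact (hHne s hs).le
  have hHeq : (fun x => H (H1.fn u x)) = fun x =>
      1 / 2 * ((f (H1.fn u x) - lam * H1.fn u x) * H1.fn u x) - potG lam f (H1.fn u x) := by
    funext x
    simp only [hH, potG]
    ring
  have hHi : Integrable fun x => H (H1.fn u x) := by
    rw [hHeq]
    exact (hgi.const_mul _).sub hGi
  have hHint : ∫ x, H (H1.fn u x) = 1 / 2 * (∫ x, (f (H1.fn u x) - lam * H1.fn u x) * H1.fn u x)
      - ∫ x, potG lam f (H1.fn u x) := by
    rw [hHeq, integral_sub (hgi.const_mul _) hGi, integral_const_mul]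
  have hHpos : 0 < ∫ x, H (H1.fn u x) := by
    refine lt_of_le_of_ne (integral_nonneg fun x => hHnn _) fun h0 => hu ?_
    have hae := (integral_eq_zero_iff_of_nonneg (fun x => hHnn (H1.fn u x)) hHi).1 h0.symm
    have hfn : H1.fn u =ᵐ[volume] (0 : RN N → ℝ) := by
      filter_upwards [hae] with x hx
      by_contra hne
      exact (hHne _ hne).ne' hx
    have hG0 : ∫ x, potG lam f (H1.fn u x) = 0 := by
      refine integral_eq_zero_of_ae ?_
      filter_upwards [hfn] with x hx
      rw [hx]
      simp [potG, hF0]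
    have hfn0 : H1.fn u = 0 := (Lp.eq_zero_iff_ae_eq_zero).2 hfn
    -- An element of `H1 N` is a pair, so its gradient must vanish too; J(u) = 0 gives this once
    -- ∫G(u) = 0.
    rw [hG0, mul_zero, sub_zero] at hJ
    have hn := H1.norm_sq_eq_add u
    rw [hJ, hfn0, norm_zero] at hn
    exact norm_eq_zero.1 (pow_eq_zero_iff two_ne_zero |>.1 (by linarith))
  have := mul_pos hκ hHpos
  rw [hHint] at this
  linarith

theorem mainTheorem3 (N : ℕ) (hN : 3 ≤ N) (lam : ℝ) (hlam : 0 < lam) (f : ℝ → ℝ)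
    (hodd : Function.Odd f)
    (hf1 : ContDiffOn ℝ 1 f (Ici 0))
    (hf2 : f =o[𝓝 0] (fun u : ℝ => u))
    (hf3 : (∃ a : ℝ, 0 < a ∧ Tendsto (fun u => f u / u) atTop (𝓝 a)) ∨
      Tendsto (fun u => f u / u) atTop atTop)
    (hf4 : ∃ a₁ a₂ p : ℝ, 0 < a₁ ∧ 0 < a₂ ∧ 2 < p ∧ p < 2 * (N : ℝ) / ((N : ℝ) - 2) ∧
      ∀ u : ℝ, 0 ≤ u → |derivWithin f (Ici 0) u| ≤ a₁ + a₂ * |u| ^ (p - 2))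
    (hNQ_lim : Tendsto (fun u => 1 / 2 * f u * u - primF f u) atTop atTop)
    (hNQ_pos : ∀ u : ℝ, 0 < u → 0 < 1 / 2 * f u * u - primF f u) :
    (∃ σ : ℝ, 0 < σ ∧ ∀ u ∈ pohozaevManifold N lam f, σ < ‖u‖) ∧
    IsClosed (pohozaevManifold N lam f) ∧
    IsC1Hypersurface (pohozaevManifold N lam f) ∧
    (∀ u : H1 N, Integrable (fun x => potG lam f (H1.fn u x))) ∧
    ContDiff ℝ 1 (pohozaevJ N lam f) ∧
    (∀ u ∈ pohozaevManifold N lam f, fderiv ℝ (pohozaevJ N lam f) u u < 0) := by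
  obtain ⟨a₁, a₂, p, ha₁, ha₂, hp2, hp, hd⟩ := hf4
  have hN' : (3 : ℝ) ≤ N := by exact_mod_cast hN
  have hκ : 0 < 2 * (N : ℝ) / ((N : ℝ) - 2) := div_pos (by linarith) (by linarith)
  have hq : 0 < p - 2 := by linarith
  obtain ⟨K, hK, hS⟩ := exists_lintegral_rpow_le hN hp2 hp
  have hS' : SobolevBound N (p - 2 + 2) K := by
    rw [sub_add_cancel]
    exact hS
  have hf0 : f 0 = 0 := hodd.map_zero
  have hfL := growthLipschitz_of_odd hq ha₂.le hodd hf1 hd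
  have hfc : Continuous f := hfL.continuous hq
  obtain ⟨hGi, hgi, D, hD, hDe, hDd⟩ := exists_fderiv_integral_primF hq hK hS'
    (add_nonneg ha₁.le hlam.le) ha₂.le (hfL.sub_const_mul hlam.le) (by simp [hf0])
  simp only [primF_sub_const_mul hfc] at hGi hDd
  have hJe : ∀ u, pohozaevJ N lam f u = ‖H1.grad u‖ ^ 2 -
      2 * (N : ℝ) / ((N : ℝ) - 2) * ∫ x, potG lam f (H1.fn u x) := fun u => by
    rw [pohozaevJ, integral_norm_sq_eq]
  obtain ⟨hJ, hJd⟩ := contDiff_pohozaevJ_aux hD hDd hJe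
  have hneg : ∀ u ∈ pohozaevManifold N lam f, fderiv ℝ (pohozaevJ N lam f) u u < 0 := by
    intro u hu
    rw [hJd, hDe]
    exact pohozaev_radial_deriv_neg hodd hκ hNQ_pos hu.1 (hGi u) (hgi u u) ((hJe u).symm.trans hu.2)
  obtain ⟨σ, hσ, hσu⟩ := exists_pos_lt_norm_of_mem_pohozaevManifold hN hlam hq hK hS' ha₁.le
    ha₂.le hfL hf0 hf2
  refine ⟨⟨σ, hσ, hσu⟩, ?_, ?_, hGi, hJ, hneg⟩
  -- The open condition u ≠ 0 is replaced by the closed condition σ ≤ ‖u‖.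
  · have hset : pohozaevManifold N lam f =
        {u | σ ≤ ‖u‖} ∩ pohozaevJ N lam f ⁻¹' {0} := by
      ext u
      refine ⟨fun hu => ⟨(hσu u hu).le, hu.2⟩, fun hu => ⟨?_, hu.2⟩⟩
      exact norm_pos_iff.1 (hσ.trans_le hu.1)
    rw [hset]
    exact (isClosed_le continuous_const continuous_norm).inter
      (isClosed_singleton.preimage hJ.continuous)
  -- The point `u` itself is a direction in which the derivative does not vanish.
  · exact isC1Hypersurface_of_contDiff hJ (isOpen_compl_singleton (x := (0 : H1 N)))
      (fun u => Iff.rfl) fun u hu => ⟨u, (hneg u hu).ne⟩
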